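/- Let $A$ be a finite set of arms. To each $a\in A$ belong a reward distribution and a cost distribution on $\mathbb R$, both supported in $[0,1]$, with means $\mu_a$ and $C_a$. Let $X_{a,t}$ and $Y_{a,t}$ ($a\in A$, $t\ge 1$) be mutually independent random variables, $X_{a,t}$ having the reward distribution and $Y_{a,t}$ the cost distribution of $a$. Let $C\in\mathbb R$ be such that $A_f:=\{a\in A : C_a\le C\}$ is nonempty, and let $\epsilon_t\in(0,1]$ for $t\ge1$. The constrained $\epsilon_t$-greedy strategy $\pi$ (which depends only on $C$, on $(\epsilon_t)$ and on a rule for breaking ties) selects the arm $I^\pi_t$ at time $t$ as follows, given the arms $I^\pi_n$, rewards $X_{I^\pi_n,n}$ and costs $Y_{I^\pi_n,n}$ of the plays $n<t$. Let $T_a$ be the number of these plays in which $a$ was played, let $\bar X_a$ and $\bar Y_a$ be the averages of the rewards and of the costs observed in them (both $0$ if $T_a=0$), and let $A_t=\{a\in A : T_a\ne0,\ \bar Y_a\le C\}$. With probability $1-\epsilon_t$, the arm is selected in $\operatorname{argmax}_{a\in A_t}\bar X_a$ (ties being broken arbitrarily) if $A_t\neq\emptyset$, and uniformly at random in $A$ if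 $A_t=\emptyset$; with probability $\epsilon_t$, it is selected uniformly at random in $A$. The samples $X_{a,t},Y_{a,t}$ of time $t$ are independent of the past plays and of $I^\pi_t$. Suppose that $\sum_{t=1}^\infty\epsilon_t=\infty$, that $\lim_{t\to\infty}\epsilon_t=0$, that $\eta:=\min_{a\in A}|C_a-C|\neq0$ and that $\rho:=\min_{a,b\in A,\ a\ne b}|\mu_a-\mu_b|\neq0$ (a condition that holds trivially if $|A|=1$). Then $$\lim_{t\to\infty}\Pr\Bigl\{I^\pi_t\in\operatorname{argmax}_{a\in A_f}\mu_a\Bigr\}=1 .$$ In other words, $\pi$ is asymptotically optimal: with $\mu^*=\max_{a\in A_f}\mu_a$ and $A_f^*=\{a\in A_f:\mu_a=\mu^*\}$, one has $\sum_{a\in A_f^*}\Pr\{I^\pi_t=a\}\to1$ as $t\to\infty$. -/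

import Mathlib

open MeasureTheory ProbabilityTheory Filter Topology
open scoped ENNReal

noncomputable section

namespace CMAB

/-- A constrained multi-armed bandit problem with set of arms `A`: playing arm `a` gives a
sample reward with distribution `rewardDist a` and a sample cost with distribution `costDist a`,
all these distributions being supported in `[0, 1]`. The constant `C` is the bound on the
expected cost of a feasible arm. -/
structure Problem (A : Type*) where
  rewardDist : A → Measure ℝ
  costDist : A → Measure ℝ
  C : ℝ
  reward_prob : ∀ a, IsProbabilityMeasure (rewardDist a)
  cost_prob : ∀ a, IsProbabilityMeasure (costDist a)
  reward_mem : ∀ a, ∀ᵐ x ∂(rewardDist a), x ∈ Set.Icc (0 : ℝ) 1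
  cost_mem : ∀ a, ∀ᵐ x ∂(costDist a), x ∈ Set.Icc (0 : ℝ) 1

/-- `argmaxOn S f` is the set `argmax_{a ∈ S} f a`. -/
def argmaxOn {A : Type*} (S : Set A) (f : A → ℝ) : Set A :=
  {a | a ∈ S ∧ ∀ b ∈ S, f b ≤ f a}

namespace Problem

variable {A : Type*} (M : Problem A)

/-- The expected reward `μ_a`. -/
def meanReward (a : A) : ℝ := ∫ x, x ∂(M.rewardDist a)

/-- The expected cost `C_a`. -/
def meanCost (a : A) : ℝ := ∫ x, x ∂(M.costDist a)

/-- The set `A_f` of feasible arms. -/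
def feasible : Set A := {a | M.meanCost a ≤ M.C}

/-- The optimal value `μ* = max_{a ∈ A_f} μ_a`. -/
def optValue : ℝ := sSup (M.meanReward '' M.feasible)

/-- The set `A*_f` of the feasible arms that attain the optimal value. -/
def optArms : Set A := {a | a ∈ M.feasible ∧ M.meanReward a = M.optValue}

/-- `η = min_a |C_a - C|`, for a finite nonempty set of arms. -/
def eta : ℝ := ⨅ a, |M.meanCost a - M.C|

/-- `ρ = min_{a ≠ b} |μ_a - μ_b|`, with value `∞` if there is only one arm. -/
def rho : ℝ≥0∞ := ⨅ (a : A) (b : A) (_ : a ≠ b),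
  ENNReal.ofReal |M.meanReward a - M.meanReward b|

end Problem

/-- The record of the first `t` plays: entry `s` is the arm that was played, followed by the
reward and the cost that were observed. Plays are numbered from `0`. -/
abbrev Hist (A : Type*) (t : ℕ) : Type _ := Fin t → A × ℝ × ℝ

section History

variable {A : Type*} {t : ℕ}

open Classical in
/-- The number of times that arm `a` was played. -/
def count (h : Hist A t) (a : A) : ℕ := (Finset.univ.filter fun s => (h s).1 = a).card

open Classical in
/-- The sample average-reward of arm `a`, and `0` if `a` was not played. -/
def avgReward (h : Hist A t) (a : A) : ℝ :=
  if 1 ≤ count h a then (1 / (count h a : ℝ)) * ∑ s, (if (h s).1 = a then (h s).2.1 else 0) else 0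

open Classical in
/-- The sample average-cost of arm `a`, and `0` if `a` was not played. -/
def avgCost (h : Hist A t) (a : A) : ℝ :=
  if 1 ≤ count h a then (1 / (count h a : ℝ)) * ∑ s, (if (h s).1 = a then (h s).2.2 else 0) else 0

/-- The set `A_t` of the arms that were played and whose sample average-cost is at most `C`. -/
def estFeasible (C : ℝ) (h : Hist A t) : Set A := {a | count h a ≠ 0 ∧ avgCost h a ≤ C}

end History

/-- A strategy maps each record of past plays to a distribution over the arms, from which the
next arm is drawn. -/
structure Strategy (A : Type*) [MeasurableSpace A] where
  select : ∀ t : ℕ, Kernel (Hist A t) A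
  markov : ∀ t : ℕ, IsMarkovKernel (select t)

/-- `π` is a constrained `ε_t`-greedy strategy with cost bound `C`: with probability `1 - ε t` the
next arm is drawn by greedy selection, from a distribution `g`, and with probability `ε t` it is
uniform over `A`. The distribution `g` is concentrated on the arms of highest sample
average-reward in the set of estimated feasible arms, ties being broken in an arbitrary, possibly
random and history-dependent way; it is uniform over `A` if that set is empty. -/
def Strategy.IsConstrainedGreedy {A : Type*} [MeasurableSpace A] (π : Strategy A) (C : ℝ)
    (ε : ℕ → ℝ) : Prop :=
  ∀ (t : ℕ) (h : Hist A t), ∃ g : Measure A, IsProbabilityMeasure g ∧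
    ((estFeasible C h).Nonempty → g (argmaxOn (estFeasible C h) (avgReward h)) = 1) ∧
    (estFeasible C h = ∅ → g = uniformOn Set.univ) ∧
    π.select t h = ENNReal.ofReal (1 - ε t) • g + ENNReal.ofReal (ε t) • uniformOn Set.univ

/-- The record of the first `t` plays, when `I s` is the arm of play `s` and `X a s`, `Y a s`
are the sample reward and the sample cost of arm `a` at play `s`. -/
def history {A Ω : Type*} (X Y : A → ℕ → Ω → ℝ) (I : ℕ → Ω → A) (t : ℕ) (ω : Ω) : Hist A t :=
  fun s => (I s ω, X (I s ω) s ω, Y (I s ω) s ω)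

/-- The random variables `X a t`, `Y a t` (sample rewards and costs) and `I t` (selected arms) on
the probability space `(Ω, P)` describe the bandit `M` played by the strategy `π`. -/
structure IsPlay {A Ω : Type*} [MeasurableSpace A] [MeasurableSpace Ω] (M : Problem A)
    (π : Strategy A) (P : Measure Ω) (X Y : A → ℕ → Ω → ℝ) (I : ℕ → Ω → A) : Prop where
  measurable_reward : ∀ a t, Measurable (X a t)
  measurable_cost : ∀ a t, Measurable (Y a t)
  measurable_arm : ∀ t, Measurable (I t)
  law_reward : ∀ a t, P.map (X a t) = M.rewardDist a
  law_cost : ∀ a t, P.map (Y a t) = M.costDist a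
  /-- All sample rewards and sample costs are mutually independent. -/
  indep_samples : iIndepFun
    (Sum.elim (fun p : A × ℕ => X p.1 p.2) (fun p : A × ℕ => Y p.1 p.2)) P
  /-- Given the record of the past plays, the next arm is distributed according to `π`. -/
  law_arm : ∀ t, P.map (fun ω => (history X Y I t ω, I t ω)) =
    (P.map (history X Y I t)) ⊗ₘ (π.select t)
  /-- The samples at time `t` are independent of the past plays and of the arm selected at `t`. -/
  indep_play : ∀ t, IndepFun (fun ω => (history X Y I t ω, I t ω))
    (fun ω => ((fun a => X a t ω), (fun a => Y a t ω))) P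

open Classical in
/-- Asymptotic optimality of the strategy that selects the arms `I t`:
`∑_{a ∈ A*_f} Pr {I t = a} → 1`. -/
def IsAsymptoticallyOptimal {A Ω : Type*} [Fintype A] [MeasurableSpace Ω] (M : Problem A)
    (P : Measure Ω) (I : ℕ → Ω → A) : Prop :=
  Tendsto (fun t => ∑ a ∈ Finset.univ.filter (fun a => a ∈ M.optArms), P {ω | I t ω = a})
    atTop (𝓝 1)

end CMAB

end

/-!
An optimal arm is selected at play `t` with conditional probability at least `1 - ε t` as soon as the
sample averages of all arms are close enough to their means: no `C_a` equals `C`, so the estimated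
feasible set is then the feasible set (`Accurate.estFeasible_eq`), and a greedy choice in it
maximizes the mean reward (`Accurate.argmaxOn_subset`). As `ε t → 0`, it suffices that the averages
converge to the means in probability (`IsPlay.tendsto_measure_not_accurate`). Two bounds on
exponential moments give this, both proved by induction on the number of plays.

* If `T` is the number of plays of arm `a`, exploration gives
  `E[2 ^ (-T)] ≤ exp (-(∑ ε) / (2 |A|))` (`IsPlay.lintegral_half_pow_count_le`). As `∑ ε = ∞`,
  every event `T < k` has a probability that tends to `0`.
* If `D` is the sum of the deviations from the mean of the rewards (or costs) observed on arm `a`,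
  then `E[exp (l D - l² T / 8)] ≤ 1` for every `l`, by Hoeffding's lemma and the independence of the
  samples of a play from the past and from the selected arm
  (`IsPlay.lintegral_exp_deviation_le_one`). Since `T` occurs in the exponent, the Chernoff bound
  `P (T ≥ k, |D| ≥ δ T) ≤ 2 exp (-2 δ² k)` holds with no knowledge of the law of `T`, and a large
  `k` makes it small uniformly in time.
-/

namespace CMAB

/-! ### Statistics of a record of plays -/

section Deviation

variable {A : Type*} {t : ℕ}

open Classical in
/-- The sum, over the plays of arm `a` in the record `h`, of the deviations from `m` of the
observation `obs`, a function of the observed reward and cost (in practice one of the two). -/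
noncomputable def deviation (obs : ℝ × ℝ → ℝ) (m : ℝ) (a : A) (h : Hist A t) : ℝ :=
  ∑ s, if (h s).1 = a then obs (h s).2 - m else 0

/-- The samples `obs` of all arms average to within `δ` of `m`, in a multiplied-out form that
also says, the inequality being strict, that every arm was played. -/
def Accurate (obs : ℝ × ℝ → ℝ) (m : A → ℝ) (δ : ℝ) (h : Hist A t) : Prop :=
  ∀ a, |deviation obs (m a) a h| < δ * count h a

variable [MeasurableSpace A] [MeasurableSingletonClass A]

lemma measurableSet_arm_eq (a : A) (s : Fin t) :
    MeasurableSet {h : Hist A t | (h s).1 = a} :=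
  (measurable_fst.comp (measurable_pi_apply s)) (measurableSet_singleton a)

lemma measurable_count (a : A) : Measurable fun h : Hist A t => count h a := by
  classical
  simp only [count, Finset.card_filter]
  exact Finset.measurable_sum _ fun s _ =>
    Measurable.ite (measurableSet_arm_eq a s) measurable_const measurable_const

lemma measurable_deviation {obs : ℝ × ℝ → ℝ} (hobs : Measurable obs) (m : ℝ) (a : A) :
    Measurable fun h : Hist A t => deviation obs m a h := by
  classical
  exact Finset.measurable_sum _ fun s _ =>
    Measurable.ite (measurableSet_arm_eq a s) (by fun_prop) measurable_const

lemma measurableSet_accurate [Countable A] {obs : ℝ × ℝ → ℝ} (hobs : Measurable obs)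
    (m : A → ℝ) (δ : ℝ) : MeasurableSet {h : Hist A t | Accurate obs m δ h} := by
  simp only [Accurate, Set.ofPred_forall]
  refine MeasurableSet.iInter fun a => measurableSet_lt ?_ ?_
  · exact (measurable_deviation hobs (m a) a).abs
  · exact measurable_const.mul (measurable_from_top.comp (measurable_count a))

end Deviation

section Averages

variable {A : Type*} {t : ℕ}

lemma Accurate.count_pos {obs : ℝ × ℝ → ℝ} {m : A → ℝ} {δ : ℝ} {h : Hist A t}
    (hh : Accurate obs m δ h) (a : A) : 0 < count h a := by
  by_contra! hc
  have h1 := hh a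
  rw [Nat.le_zero.mp hc] at h1
  simp only [Nat.cast_zero, mul_zero] at h1
  exact absurd h1 (abs_nonneg _).not_gt

open Classical in
lemma Accurate.abs_average_sub_lt {obs : ℝ × ℝ → ℝ} {m : A → ℝ} {δ : ℝ} {h : Hist A t}
    (hh : Accurate obs m δ h) (a : A) :
    |(1 / (count h a : ℝ)) * ∑ s, (if (h s).1 = a then obs (h s).2 else 0) - m a| < δ := by
  have hpos : (0 : ℝ) < count h a := by exact_mod_cast hh.count_pos a
  have hdev : deviation obs (m a) a h =
      ∑ s, (if (h s).1 = a then obs (h s).2 else 0) - count h a * m a := by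
    simp only [deviation, count, Finset.card_filter, Nat.cast_sum, Finset.sum_mul,
      ← Finset.sum_sub_distrib]
    refine Finset.sum_congr rfl fun s _ => ?_
    split_ifs <;> simp
  have h1 := hh a
  rw [hdev] at h1
  have h2 : (1 / (count h a : ℝ)) * ∑ s, (if (h s).1 = a then obs (h s).2 else 0) - m a =
      (∑ s, (if (h s).1 = a then obs (h s).2 else 0) - count h a * m a) / count h a := by
    field_simp
  rwa [h2, abs_div, abs_of_pos hpos, div_lt_iff₀ hpos]

lemma Accurate.abs_avgReward_sub_lt {m : A → ℝ} {δ : ℝ} {h : Hist A t}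
    (hh : Accurate Prod.fst m δ h) (a : A) : |avgReward h a - m a| < δ := by
  rw [avgReward, if_pos (Nat.succ_le_of_lt (hh.count_pos a))]
  exact hh.abs_average_sub_lt a

lemma Accurate.abs_avgCost_sub_lt {m : A → ℝ} {δ : ℝ} {h : Hist A t}
    (hh : Accurate Prod.snd m δ h) (a : A) : |avgCost h a - m a| < δ := by
  rw [avgCost, if_pos (Nat.succ_le_of_lt (hh.count_pos a))]
  exact hh.abs_average_sub_lt a

/-- Once the average costs are within `δ` of their means, and no mean is closer than `δ` to the
bound `C`, exactly the feasible arms are estimated to be feasible. -/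
lemma Accurate.estFeasible_eq (M : Problem A) {δ : ℝ} {h : Hist A t}
    (hh : Accurate Prod.snd M.meanCost δ h) (hδ : ∀ a, δ ≤ |M.meanCost a - M.C|) :
    estFeasible M.C h = M.feasible := by
  ext a
  have h1 := abs_lt.mp (hh.abs_avgCost_sub_lt a)
  have h2 := hδ a
  simp only [estFeasible, Problem.feasible, Set.mem_ofPred_eq, (hh.count_pos a).ne', ne_eq,
    not_false_eq_true, true_and]
  constructor
  · intro h3
    by_contra! h4
    rw [abs_of_pos (by linarith)] at h2
    linarith
  · intro h3
    rw [abs_of_nonpos (by linarith)] at h2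
    linarith

/-- Once the average rewards are within `δ` of their means, and distinct means differ by at least
`2 * δ`, an arm of highest average reward has the highest mean reward. -/
lemma Accurate.argmaxOn_subset {m : A → ℝ} {δ : ℝ} {h : Hist A t}
    (hh : Accurate Prod.fst m δ h) (hδ : ∀ a b, 0 < m b - m a → 2 * δ ≤ m b - m a)
    (S : Set A) : argmaxOn S (avgReward h) ⊆ argmaxOn S m := by
  rintro a ⟨ha, hmax⟩
  refine ⟨ha, fun b hb => ?_⟩
  by_contra! hlt
  have h1 := abs_lt.mp (hh.abs_avgReward_sub_lt a)
  have h2 := abs_lt.mp (hh.abs_avgReward_sub_lt b)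
  have h3 := hδ a b (by linarith)
  have h4 := hmax b hb
  linarith

end Averages

/-! ### Greedy selection from accurate averages -/

/-- Positive values of a function on a finite type are bounded away from `0`; this yields the
margins within which the averages have to be accurate. -/
lemma exists_pos_le_of_pos {ι : Type*} [Finite ι] (f : ι → ℝ) :
    ∃ δ > 0, ∀ i, 0 < f i → δ ≤ f i := by
  have h : ∀ i, ∀ᶠ δ in 𝓝[>] (0 : ℝ), 0 < f i → δ ≤ f i := fun i => by
    by_cases hi : 0 < f i
    · filter_upwards [Ioo_mem_nhdsGT hi] with δ hδ _ using hδ.2.le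
    · exact Eventually.of_forall fun δ h => absurd h hi
  obtain ⟨δ, h1, h2⟩ := ((eventually_all.mpr h).and self_mem_nhdsWithin).exists
  exact ⟨δ, h2, h1⟩

lemma Problem.meanCost_ne_of_eta_ne_zero {A : Type*} [Finite A] {M : Problem A} (hη : M.eta ≠ 0)
    (a : A) : M.meanCost a ≠ M.C := by
  intro h
  refine hη (le_antisymm ?_ (Real.iInf_nonneg fun _ => abs_nonneg _))
  refine (ciInf_le (Set.finite_range _).bddBelow a).trans ?_
  simp [h]

lemma Problem.optArms_eq_argmaxOn {A : Type*} [Finite A] (M : Problem A) :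
    M.optArms = argmaxOn M.feasible M.meanReward := by
  ext a
  have hbdd : BddAbove (M.meanReward '' M.feasible) := (Set.toFinite _).bddAbove
  constructor
  · rintro ⟨ha, hopt⟩
    exact ⟨ha, fun b hb => hopt ▸ le_csSup hbdd (Set.mem_image_of_mem _ hb)⟩
  · rintro ⟨ha, hmax⟩
    refine ⟨ha, le_antisymm (le_csSup hbdd (Set.mem_image_of_mem _ ha)) ?_⟩
    refine csSup_le ⟨_, Set.mem_image_of_mem _ ha⟩ ?_
    rintro _ ⟨b, hb, rfl⟩
    exact hmax b hb

/-- On a record whose averages are all accurate, the greedy part of the strategy selects an optimal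
arm, so that an optimal arm is missed only in the exploration, of probability `ε t`. -/
lemma Strategy.IsConstrainedGreedy.le_select_argmaxOn {A : Type*} [MeasurableSpace A]
    {M : Problem A} {π : Strategy A} {ε : ℕ → ℝ} {δ : ℝ}
    (hπ : π.IsConstrainedGreedy M.C ε) (hfeas : M.feasible.Nonempty)
    (hδ_cost : ∀ a, δ ≤ |M.meanCost a - M.C|)
    (hδ_reward : ∀ a b, 0 < M.meanReward b - M.meanReward a →
      2 * δ ≤ M.meanReward b - M.meanReward a)
    {t : ℕ} {h : Hist A t} (hreward : Accurate Prod.fst M.meanReward δ h)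
    (hcost : Accurate Prod.snd M.meanCost δ h) :
    ENNReal.ofReal (1 - ε t) ≤ π.select t h (argmaxOn M.feasible M.meanReward) := by
  obtain ⟨g, -, hg, -, hsel⟩ := hπ t h
  rw [hcost.estFeasible_eq M hδ_cost] at hg
  have h1 : 1 ≤ g (argmaxOn M.feasible M.meanReward) :=
    (hg hfeas).ge.trans (measure_mono (hreward.argmaxOn_subset hδ_reward _))
  rw [hsel, Measure.add_apply, Measure.smul_apply, smul_eq_mul]
  exact (le_mul_of_one_le_right' h1).trans le_self_add

/-! ### Recursion along the plays -/

section Recursion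

variable {A Ω : Type*} (X Y : A → ℕ → Ω → ℝ) (I : ℕ → Ω → A) (t : ℕ) (ω : Ω)

open Classical in
lemma count_history_succ (a : A) :
    count (history X Y I (t + 1) ω) a =
      count (history X Y I t ω) a + if I t ω = a then 1 else 0 := by
  simp only [count, Finset.card_filter, Fin.sum_univ_castSucc]
  rfl

open Classical in
lemma deviation_history_succ (obs : ℝ × ℝ → ℝ) (m : ℝ) (a : A) :
    deviation obs m a (history X Y I (t + 1) ω) =
      deviation obs m a (history X Y I t ω) +
        if I t ω = a then obs (X a t ω, Y a t ω) - m else 0 := by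
  simp only [deviation, Fin.sum_univ_castSucc]
  change _ + (if I t ω = a then obs (X (I t ω) t ω, Y (I t ω) t ω) - m else 0) = _
  by_cases h : I t ω = a
  · subst h
    rfl
  · simp only [if_neg h]
    rfl

end Recursion

section Play

variable {A Ω : Type*} [MeasurableSpace A] [MeasurableSingletonClass A] [MeasurableSpace Ω]
  {P : Measure Ω} {M : Problem A} {π : Strategy A} {X Y : A → ℕ → Ω → ℝ} {I : ℕ → Ω → A}

lemma IsPlay.measurable_history [Countable A] (hplay : IsPlay M π P X Y I) (t : ℕ) :
    Measurable (history X Y I t) := by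
  have hX : ∀ s, Measurable fun ω => X (I s ω) s ω := fun s =>
    (measurable_from_prod_countable_right (f := fun p : A × Ω => X p.1 s p.2)
      fun a => hplay.measurable_reward a s).comp ((hplay.measurable_arm s).prodMk measurable_id)
  have hY : ∀ s, Measurable fun ω => Y (I s ω) s ω := fun s =>
    (measurable_from_prod_countable_right (f := fun p : A × Ω => Y p.1 s p.2)
      fun a => hplay.measurable_cost a s).comp ((hplay.measurable_arm s).prodMk measurable_id)
  exact measurable_pi_lambda _ fun s =>
    (hplay.measurable_arm s).prodMk ((hX s).prodMk (hY s))

/-! ### Every arm is played infinitely often, in probability -/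

lemma Strategy.IsConstrainedGreedy.le_select_singleton [Fintype A] {C : ℝ} {ε : ℕ → ℝ}
    (hπ : π.IsConstrainedGreedy C ε) (t : ℕ) (h : Hist A t) (a : A) :
    ENNReal.ofReal (ε t) * (Fintype.card A : ℝ≥0∞)⁻¹ ≤ π.select t h {a} := by
  obtain ⟨g, -, -, -, hg⟩ := hπ t h
  rw [hg, Measure.add_apply, Measure.smul_apply, Measure.smul_apply, uniformOn_univ,
    Measure.count_singleton, one_div, smul_eq_mul, smul_eq_mul]
  exact le_add_self

/-- The factor by which a draw from `κ` changes the expectation of `2⁻¹ ^ T`, when `T` counts the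
draws of `a` and `a` has probability at least `2 * p`. -/
lemma lintegral_ite_half_le [Countable A] (κ : Measure A) [IsProbabilityMeasure κ] (a : A) (p : ℝ)
    (hp : ENNReal.ofReal (2 * p) ≤ κ {a}) [∀ b, Decidable (b = a)] :
    ∫⁻ b, (if b = a then 2⁻¹ else 1) ∂κ ≤ ENNReal.ofReal (Real.exp (-p)) := by
  have h1 : ∫⁻ b, (if b = a then 2⁻¹ else 1) ∂κ + 2⁻¹ * κ {a} = 1 := by
    have h2 : 2⁻¹ * κ {a} = ∫⁻ b, ({a} : Set A).indicator (fun _ => 2⁻¹) b ∂κ := by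
      rw [lintegral_indicator (measurableSet_singleton a)]; simp
    rw [h2, ← lintegral_add_left (measurable_of_countable _)]
    have h3 : ∀ b, ((if b = a then 2⁻¹ else 1) + ({a} : Set A).indicator (fun _ => 2⁻¹) b : ℝ≥0∞)
        = 1 := by
      intro b
      by_cases hb : b = a
      · simp [hb, ENNReal.inv_two_add_inv_two]
      · simp [hb]
    simp [h3]
  have h4 : ENNReal.ofReal p ≤ 2⁻¹ * κ {a} := by
    refine le_trans (le_of_eq ?_) (mul_le_mul_right hp 2⁻¹)
    rw [ENNReal.ofReal_mul (by norm_num), ← mul_assoc, ENNReal.ofReal_ofNat,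
      ENNReal.inv_mul_cancel (by norm_num) (by norm_num), one_mul]
  have h5 : ∫⁻ b, (if b = a then 2⁻¹ else 1) ∂κ + ENNReal.ofReal p ≤ 1 :=
    (add_le_add_right h4 _).trans h1.le
  calc ∫⁻ b, (if b = a then 2⁻¹ else 1) ∂κ
      ≤ 1 - ENNReal.ofReal p := ENNReal.le_sub_of_add_le_right ENNReal.ofReal_ne_top h5
    _ ≤ ENNReal.ofReal (1 - p) := by
        rw [← ENNReal.ofReal_one]
        rcases le_total 0 p with h0 | h0
        · rw [ENNReal.ofReal_sub _ h0]
        · rw [ENNReal.ofReal_of_nonpos h0, tsub_zero]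
          exact ENNReal.ofReal_le_ofReal (by linarith)
    _ ≤ ENNReal.ofReal (Real.exp (-p)) :=
        ENNReal.ofReal_le_ofReal (Real.one_sub_le_exp_neg p)

/-- Whatever the past, arm `a` is explored at play `s` with probability at least `ε s / |A|`, so
each play shrinks the expectation of `2⁻¹ ^ count` by a factor `exp (- ε s / (2 * |A|))`. -/
lemma IsPlay.lintegral_half_pow_count_le [Fintype A] [IsProbabilityMeasure P]
    (hplay : IsPlay M π P X Y I) {C : ℝ} {ε : ℕ → ℝ} (hε : ∀ t, 0 ≤ ε t)
    (hπ : π.IsConstrainedGreedy C ε) (a : A) (t : ℕ) :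
    ∫⁻ ω, (2⁻¹ : ℝ≥0∞) ^ count (history X Y I t ω) a ∂P ≤
      ENNReal.ofReal (Real.exp (-(2 * Fintype.card A : ℝ)⁻¹ * ∑ s ∈ Finset.range t, ε s)) := by
  classical
  induction t with
  | zero => simp [count]
  | succ t ih =>
    have := π.markov t
    have hcard : (0 : ℝ) < Fintype.card A := by
      exact_mod_cast Fintype.card_pos_iff.mpr ⟨a⟩
    have hH := hplay.measurable_history t
    have : IsProbabilityMeasure (P.map (history X Y I t)) :=
      Measure.isProbabilityMeasure_map hH.aemeasurable
    have hpow : Measurable fun h : Hist A t => (2⁻¹ : ℝ≥0∞) ^ count h a :=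
      measurable_from_top.comp (measurable_count a)
    have hfac : Measurable fun b : A => (if b = a then 2⁻¹ else 1 : ℝ≥0∞) :=
      measurable_of_countable _
    have hF : Measurable fun q : Hist A t × A =>
        (2⁻¹ : ℝ≥0∞) ^ count q.1 a * (if q.2 = a then 2⁻¹ else 1) :=
      (hpow.comp measurable_fst).mul (hfac.comp measurable_snd)
    have hp : ∀ h : Hist A t,
        ENNReal.ofReal (2 * ((2 * Fintype.card A : ℝ)⁻¹ * ε t)) ≤ π.select t h {a} := by
      intro h
      refine le_trans (le_of_eq ?_) (hπ.le_select_singleton t h a)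
      rw [show 2 * ((2 * Fintype.card A : ℝ)⁻¹ * ε t) = ε t * (Fintype.card A : ℝ)⁻¹ by
        field_simp, ENNReal.ofReal_mul (hε t), ENNReal.ofReal_inv_of_pos hcard,
        ENNReal.ofReal_natCast]
    calc ∫⁻ ω, (2⁻¹ : ℝ≥0∞) ^ count (history X Y I (t + 1) ω) a ∂P
        = ∫⁻ ω, (fun q : Hist A t × A =>
            (2⁻¹ : ℝ≥0∞) ^ count q.1 a * (if q.2 = a then 2⁻¹ else 1))
              (history X Y I t ω, I t ω) ∂P := by
          refine lintegral_congr fun ω => ?_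
          simp only [count_history_succ, pow_add]
          split_ifs <;> simp
      _ = ∫⁻ h, ∫⁻ b, (2⁻¹ : ℝ≥0∞) ^ count h a * (if b = a then 2⁻¹ else 1)
            ∂(π.select t h) ∂(P.map (history X Y I t)) := by
          rw [← lintegral_map hF (hH.prodMk (hplay.measurable_arm t)), hplay.law_arm t,
            Measure.lintegral_compProd hF]
      _ ≤ ∫⁻ h, (2⁻¹ : ℝ≥0∞) ^ count h a *
            ENNReal.ofReal (Real.exp (-((2 * Fintype.card A : ℝ)⁻¹ * ε t)))
            ∂(P.map (history X Y I t)) := by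
          refine lintegral_mono fun h => ?_
          rw [lintegral_const_mul _ hfac]
          exact mul_le_mul_right (lintegral_ite_half_le _ a _ (hp h)) _
      _ = (∫⁻ ω, (2⁻¹ : ℝ≥0∞) ^ count (history X Y I t ω) a ∂P) *
            ENNReal.ofReal (Real.exp (-((2 * Fintype.card A : ℝ)⁻¹ * ε t))) := by
          rw [lintegral_mul_const _ hpow, lintegral_map hpow hH]
      _ ≤ _ := by
          refine (mul_le_mul_left ih _).trans (le_of_eq ?_)
          rw [← ENNReal.ofReal_mul (Real.exp_pos _).le, ← Real.exp_add, Finset.sum_range_succ]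
          congr 2
          ring

lemma IsPlay.tendsto_measure_count_lt [Fintype A] [IsProbabilityMeasure P]
    (hplay : IsPlay M π P X Y I) {C : ℝ} {ε : ℕ → ℝ} (hε : ∀ t, 0 ≤ ε t)
    (hπ : π.IsConstrainedGreedy C ε)
    (hsum : Tendsto (fun n => ∑ t ∈ Finset.range n, ε t) atTop atTop) (a : A) (k : ℕ) :
    Tendsto (fun t => P {ω | count (history X Y I t ω) a < k}) atTop (𝓝 0) := by
  have hcard : (0 : ℝ) < Fintype.card A := by
    exact_mod_cast Fintype.card_pos_iff.mpr ⟨a⟩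
  have hlim : Tendsto (fun t => 2 ^ k * ENNReal.ofReal
      (Real.exp (-(2 * Fintype.card A : ℝ)⁻¹ * ∑ s ∈ Finset.range t, ε s))) atTop (𝓝 0) := by
    have h1 : Tendsto (fun t => -(2 * Fintype.card A : ℝ)⁻¹ * ∑ s ∈ Finset.range t, ε s)
        atTop atBot :=
      hsum.const_mul_atTop_of_neg (neg_neg_of_pos (by positivity))
    have h2 := ENNReal.tendsto_ofReal (Real.tendsto_exp_atBot.comp h1)
    have h3 := ENNReal.Tendsto.const_mul (a := 2 ^ k) h2
      (Or.inr (ENNReal.pow_ne_top ENNReal.ofNat_ne_top))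
    simpa using h3
  refine tendsto_of_tendsto_of_tendsto_of_le_of_le tendsto_const_nhds hlim
    (fun _ => zero_le) fun t => ?_
  have hpow : Measurable fun ω => (2⁻¹ : ℝ≥0∞) ^ count (history X Y I t ω) a :=
    measurable_from_top.comp ((measurable_count a).comp (hplay.measurable_history t))
  have h4 := (mul_meas_ge_le_lintegral hpow (2⁻¹ ^ k) (μ := P)).trans
    (hplay.lintegral_half_pow_count_le hε hπ a t)
  have h5 : P {ω | count (history X Y I t ω) a < k} ≤
      P {ω | (2⁻¹ : ℝ≥0∞) ^ k ≤ 2⁻¹ ^ count (history X Y I t ω) a} :=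
    measure_mono fun ω hω => pow_le_pow_right_of_le_one' (a := (2⁻¹ : ℝ≥0∞)) (by simp) (le_of_lt hω)
  calc P {ω | count (history X Y I t ω) a < k}
      = 2 ^ k * (2⁻¹ ^ k * P {ω | count (history X Y I t ω) a < k}) := by
        rw [← mul_assoc, ← mul_pow, ENNReal.mul_inv_cancel (by norm_num) (by norm_num), one_pow,
          one_mul]
    _ ≤ _ := mul_le_mul_right ((mul_le_mul_right h5 _).trans h4) _

/-! ### The averages are close to the means, in probability -/

/-- Hoeffding's lemma for a sample in `[0, 1]`, normalized by its bound. -/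
lemma lintegral_exp_sub_le_one [IsProbabilityMeasure P] {Z : Ω → ℝ} (hZ : Measurable Z)
    (hmem : ∀ᵐ ω ∂P, Z ω ∈ Set.Icc (0 : ℝ) 1) (l : ℝ) :
    ∫⁻ ω, ENNReal.ofReal (Real.exp (l * (Z ω - ∫ x, Z x ∂P) - l ^ 2 / 8)) ∂P ≤ 1 := by
  have hsub := hasSubgaussianMGF_of_mem_Icc hZ.aemeasurable hmem
  have hmgf := hsub.mgf_le l
  have hint := hsub.integrable_exp_mul l
  have h1 : ∀ ω, Real.exp (l * (Z ω - ∫ x, Z x ∂P) - l ^ 2 / 8) =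
      Real.exp (l * (Z ω - ∫ x, Z x ∂P)) * Real.exp (-(l ^ 2 / 8)) := fun ω => by
    rw [← Real.exp_add, sub_eq_add_neg]
  simp_rw [h1]
  rw [← ofReal_integral_eq_lintegral_ofReal (hint.mul_const _)
    (Eventually.of_forall fun ω => by positivity), integral_mul_const, ENNReal.ofReal_le_one]
  calc _ ≤ Real.exp (l ^ 2 / 8) * Real.exp (-(l ^ 2 / 8)) := by
        refine mul_le_mul_of_nonneg_right (hmgf.trans (le_of_eq ?_)) (Real.exp_pos _).le
        congr 1
        simp
        ring
    _ = 1 := by rw [← Real.exp_add]; simp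

/-- For every `l`, the process `exp (l * deviation - l ^ 2 / 8 * count)` is a supermartingale that
starts at `1`: the sample of play `t` is independent of the past and of the arm played, so that
Hoeffding's lemma applies to the increment. -/
lemma IsPlay.lintegral_exp_deviation_le_one [Countable A] [IsProbabilityMeasure P]
    (hplay : IsPlay M π P X Y I) {obs : ℝ × ℝ → ℝ} (hobs : Measurable obs) (m : ℝ) (a : A)
    (hmem : ∀ t, ∀ᵐ ω ∂P, obs (X a t ω, Y a t ω) ∈ Set.Icc (0 : ℝ) 1)
    (hmean : ∀ t, ∫ ω, obs (X a t ω, Y a t ω) ∂P = m) (l : ℝ) (t : ℕ) :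
    ∫⁻ ω, ENNReal.ofReal (Real.exp (l * deviation obs m a (history X Y I t ω) -
      l ^ 2 / 8 * count (history X Y I t ω) a)) ∂P ≤ 1 := by
  classical
  induction t with
  | zero => simp [deviation, count]
  | succ t ih =>
    have hH := hplay.measurable_history t
    set E : Hist A t → ℝ≥0∞ := fun h =>
      ENNReal.ofReal (Real.exp (l * deviation obs m a h - l ^ 2 / 8 * count h a)) with hE
    set F : Hist A t × A → ℝ≥0∞ := fun q => if q.2 = a then E q.1 else 0 with hF
    set G : Hist A t × A → ℝ≥0∞ := fun q => if q.2 = a then 0 else E q.1 with hG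
    set φ : (A → ℝ) × (A → ℝ) → ℝ≥0∞ := fun v =>
      ENNReal.ofReal (Real.exp (l * (obs (v.1 a, v.2 a) - m) - l ^ 2 / 8)) with hφ
    have hEm : Measurable E := by
      have h1 := measurable_deviation (t := t) hobs m a
      have h2 : Measurable fun h : Hist A t => (count h a : ℝ) :=
        measurable_from_top.comp (measurable_count a)
      fun_prop
    have hset : MeasurableSet {q : Hist A t × A | q.2 = a} :=
      measurable_snd (measurableSet_singleton a)
    have hFm : Measurable F := Measurable.ite hset (hEm.comp measurable_fst) measurable_const
    have hGm : Measurable G := Measurable.ite hset measurable_const (hEm.comp measurable_fst)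
    have hφm : Measurable φ := by fun_prop
    have hWm : Measurable fun ω => (history X Y I t ω, I t ω) := hH.prodMk (hplay.measurable_arm t)
    have hGW : Measurable fun ω => G (history X Y I t ω, I t ω) := hGm.comp hWm
    have hVm : Measurable fun ω => ((fun a => X a t ω), (fun a => Y a t ω)) :=
      (measurable_pi_lambda _ fun a => hplay.measurable_reward a t).prodMk
        (measurable_pi_lambda _ fun a => hplay.measurable_cost a t)
    have hZm : Measurable fun ω => obs (X a t ω, Y a t ω) :=
      hobs.comp ((hplay.measurable_reward a t).prodMk (hplay.measurable_cost a t))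
    have hstep : ∀ ω, ENNReal.ofReal (Real.exp (l * deviation obs m a (history X Y I (t + 1) ω) -
        l ^ 2 / 8 * count (history X Y I (t + 1) ω) a)) =
        G (history X Y I t ω, I t ω) + F (history X Y I t ω, I t ω) *
          φ ((fun a => X a t ω), (fun a => Y a t ω)) := by
      intro ω
      rw [deviation_history_succ, count_history_succ]
      by_cases h : I t ω = a
      · simp only [hF, hG, hφ, hE, h, if_true, zero_add]
        rw [← ENNReal.ofReal_mul (Real.exp_pos _).le, ← Real.exp_add]
        congr 2
        push_cast
        ring
      · simp [hF, hG, hE, h]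
    have hind := (hplay.indep_play t).comp hFm hφm
    have hone : ∫⁻ ω, φ ((fun a => X a t ω), (fun a => Y a t ω)) ∂P ≤ 1 := by
      have := lintegral_exp_sub_le_one hZm (hmem t) l
      rwa [hmean t] at this
    calc _ = ∫⁻ ω, G (history X Y I t ω, I t ω) ∂P + ∫⁻ ω, F (history X Y I t ω, I t ω) *
          φ ((fun a => X a t ω), (fun a => Y a t ω)) ∂P := by
          rw [lintegral_congr hstep, lintegral_add_left hGW]
      _ = ∫⁻ ω, G (history X Y I t ω, I t ω) ∂P + (∫⁻ ω, F (history X Y I t ω, I t ω) ∂P) *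
          ∫⁻ ω, φ ((fun a => X a t ω), (fun a => Y a t ω)) ∂P := by
          congr 1
          exact lintegral_mul_eq_lintegral_mul_lintegral_of_indepFun (hFm.comp hWm)
            (hφm.comp hVm) hind
      _ ≤ ∫⁻ ω, G (history X Y I t ω, I t ω) ∂P + (∫⁻ ω, F (history X Y I t ω, I t ω) ∂P) * 1 :=
          add_le_add_right (mul_le_mul_right hone _) _
      _ = ∫⁻ ω, E (history X Y I t ω) ∂P := by
          rw [mul_one, ← lintegral_add_left hGW]
          refine lintegral_congr fun ω => ?_
          by_cases h : I t ω = a <;> simp [hF, hG, h]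
      _ ≤ 1 := ih

/-- A Chernoff bound for the self-normalized deviation, above or below according to the sign `σ`. -/
lemma IsPlay.measure_deviation_ge_le [Countable A] [IsProbabilityMeasure P]
    (hplay : IsPlay M π P X Y I) {obs : ℝ × ℝ → ℝ} (hobs : Measurable obs) (m : ℝ) (a : A)
    (hmem : ∀ t, ∀ᵐ ω ∂P, obs (X a t ω, Y a t ω) ∈ Set.Icc (0 : ℝ) 1)
    (hmean : ∀ t, ∫ ω, obs (X a t ω, Y a t ω) ∂P = m) {σ : ℝ} (hσ : σ ^ 2 = 1) {δ : ℝ}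
    (hδ : 0 ≤ δ) (k t : ℕ) :
    P {ω | k ≤ count (history X Y I t ω) a ∧ δ * count (history X Y I t ω) a ≤
        σ * deviation obs m a (history X Y I t ω)} ≤
      ENNReal.ofReal (Real.exp (-(2 * δ ^ 2 * k))) := by
  have hH := hplay.measurable_history t
  -- `4 * δ` maximizes `l * δ - l ^ 2 / 8`.
  have h1 := hplay.lintegral_exp_deviation_le_one hobs m a hmem hmean (4 * δ * σ) t
  have hm : Measurable fun ω => ENNReal.ofReal (Real.exp
      (4 * δ * σ * deviation obs m a (history X Y I t ω) -
        (4 * δ * σ) ^ 2 / 8 * count (history X Y I t ω) a)) := by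
    have h2 : Measurable fun ω => deviation obs m a (history X Y I t ω) :=
      (measurable_deviation hobs m a).comp hH
    have h3 : Measurable fun ω => (count (history X Y I t ω) a : ℝ) :=
      measurable_from_top.comp ((measurable_count a).comp hH)
    fun_prop
  have h4 := (mul_meas_ge_le_lintegral hm (ENNReal.ofReal (Real.exp (2 * δ ^ 2 * k)))).trans h1
  set S := {ω | k ≤ count (history X Y I t ω) a ∧ δ * count (history X Y I t ω) a ≤
        σ * deviation obs m a (history X Y I t ω)}
  have h5 : ENNReal.ofReal (Real.exp (2 * δ ^ 2 * k)) * P S ≤ 1 := by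
    refine (mul_le_mul_right (measure_mono ?_) _).trans h4
    rintro ω ⟨hk, hdev⟩
    refine ENNReal.ofReal_le_ofReal (Real.exp_le_exp.mpr ?_)
    have hk' : (k : ℝ) ≤ count (history X Y I t ω) a := by exact_mod_cast hk
    have h6 := mul_le_mul_of_nonneg_left hdev (show 0 ≤ 4 * δ by positivity)
    have h7 := mul_le_mul_of_nonneg_left hk' (show 0 ≤ 2 * δ ^ 2 by positivity)
    rw [mul_pow, hσ]
    linarith
  calc P S = ENNReal.ofReal (Real.exp (-(2 * δ ^ 2 * k))) *
        (ENNReal.ofReal (Real.exp (2 * δ ^ 2 * k)) * P S) := by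
        rw [← mul_assoc, ← ENNReal.ofReal_mul (Real.exp_pos _).le, ← Real.exp_add,
          neg_add_cancel, Real.exp_zero, ENNReal.ofReal_one, one_mul]
    _ ≤ _ := mul_le_of_le_one_right' h5

/-- The event contains that of `a` not having been played yet. It is split according to whether `a`
was played fewer than `k` times, where the divergence of `∑ ε` applies, or at least `k` times, where
the Chernoff bound is uniform in `t`. -/
lemma IsPlay.tendsto_measure_deviation_ge [Fintype A] [IsProbabilityMeasure P]
    (hplay : IsPlay M π P X Y I) {C : ℝ} {ε : ℕ → ℝ} (hε : ∀ t, 0 ≤ ε t)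
    (hπ : π.IsConstrainedGreedy C ε)
    (hsum : Tendsto (fun n => ∑ t ∈ Finset.range n, ε t) atTop atTop)
    {obs : ℝ × ℝ → ℝ} (hobs : Measurable obs) (m : ℝ) (a : A)
    (hmem : ∀ t, ∀ᵐ ω ∂P, obs (X a t ω, Y a t ω) ∈ Set.Icc (0 : ℝ) 1)
    (hmean : ∀ t, ∫ ω, obs (X a t ω, Y a t ω) ∂P = m) {δ : ℝ} (hδ : 0 < δ) :
    Tendsto (fun t => P {ω | δ * count (history X Y I t ω) a ≤
      |deviation obs m a (history X Y I t ω)|}) atTop (𝓝 0) := by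
  have hbound : ∀ k t : ℕ, P {ω | δ * count (history X Y I t ω) a ≤
      |deviation obs m a (history X Y I t ω)|} ≤ P {ω | count (history X Y I t ω) a < k} +
        2 * ENNReal.ofReal (Real.exp (-(2 * δ ^ 2 * k))) := by
    intro k t
    have hpos := hplay.measure_deviation_ge_le hobs m a hmem hmean
      (show (1 : ℝ) ^ 2 = 1 by norm_num) hδ.le k t
    have hneg := hplay.measure_deviation_ge_le hobs m a hmem hmean
      (show (-1 : ℝ) ^ 2 = 1 by norm_num) hδ.le k t
    rw [two_mul]
    refine le_trans ?_ (add_le_add_right (add_le_add hpos hneg) _)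
    refine le_trans (measure_mono ?_) ((measure_union_le _ _).trans
      (add_le_add_right (measure_union_le _ _) _))
    intro ω hω
    rcases lt_or_ge (count (history X Y I t ω) a) k with hk | hk
    · exact Or.inl hk
    · rcases abs_choice (deviation obs m a (history X Y I t ω)) with h | h
      · exact Or.inr (Or.inl ⟨hk, by rw [one_mul, ← h]; exact hω⟩)
      · exact Or.inr (Or.inr ⟨hk, by rw [neg_one_mul, ← h]; exact hω⟩)
  have htail : Tendsto (fun k : ℕ => 2 * ENNReal.ofReal (Real.exp (-(2 * δ ^ 2 * k))))
      atTop (𝓝 0) := by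
    have h1 : Tendsto (fun k : ℕ => -(2 * δ ^ 2 * (k : ℝ))) atTop atBot :=
      tendsto_neg_atTop_atBot.comp
        (tendsto_natCast_atTop_atTop.const_mul_atTop (by positivity))
    have h2 := ENNReal.tendsto_ofReal (Real.tendsto_exp_atBot.comp h1)
    have h3 := ENNReal.Tendsto.const_mul (a := 2) h2 (Or.inr ENNReal.ofNat_ne_top)
    simpa using h3
  rw [ENNReal.tendsto_nhds_zero] at htail ⊢
  intro r hr
  have hr2 : 0 < r / 2 := ENNReal.half_pos hr.ne'
  obtain ⟨k, hk⟩ := (htail (r / 2) hr2).exists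
  have hcount := ENNReal.tendsto_nhds_zero.mp
    (hplay.tendsto_measure_count_lt hε hπ hsum a k) (r / 2) hr2
  filter_upwards [hcount] with t ht
  exact (hbound k t).trans ((add_le_add ht hk).trans_eq (ENNReal.add_halves r))

lemma IsPlay.tendsto_measure_not_accurate [Fintype A] [IsProbabilityMeasure P]
    (hplay : IsPlay M π P X Y I) {C : ℝ} {ε : ℕ → ℝ} (hε : ∀ t, 0 ≤ ε t)
    (hπ : π.IsConstrainedGreedy C ε)
    (hsum : Tendsto (fun n => ∑ t ∈ Finset.range n, ε t) atTop atTop)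
    {obs : ℝ × ℝ → ℝ} (hobs : Measurable obs) (m : A → ℝ)
    (hmem : ∀ a t, ∀ᵐ ω ∂P, obs (X a t ω, Y a t ω) ∈ Set.Icc (0 : ℝ) 1)
    (hmean : ∀ a t, ∫ ω, obs (X a t ω, Y a t ω) ∂P = m a) {δ : ℝ} (hδ : 0 < δ) :
    Tendsto (fun t => P {ω | ¬ Accurate obs m δ (history X Y I t ω)}) atTop (𝓝 0) := by
  have hlim := tendsto_finsetSum (Finset.univ : Finset A) fun a _ =>
    hplay.tendsto_measure_deviation_ge hε hπ hsum hobs (m a) a (hmem a) (hmean a) hδ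
  rw [Finset.sum_const_zero] at hlim
  refine tendsto_of_tendsto_of_tendsto_of_le_of_le tendsto_const_nhds hlim
    (fun _ => zero_le) fun t => ?_
  refine (measure_mono ?_).trans (measure_biUnion_finset_le Finset.univ _)
  intro ω hω
  obtain ⟨a, ha⟩ := not_forall.mp hω
  exact Set.mem_biUnion (Finset.mem_univ a) (not_lt.mp ha)

/-! ### Convergence of the probability of an optimal arm -/

lemma IsPlay.measure_arm_mem [Countable A] [IsProbabilityMeasure P] (hplay : IsPlay M π P X Y I)
    (S : Set A) (t : ℕ) :
    P {ω | I t ω ∈ S} = ∫⁻ ω, π.select t (history X Y I t ω) S ∂P := by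
  have := π.markov t
  have hH := hplay.measurable_history t
  have : IsProbabilityMeasure (P.map (history X Y I t)) :=
    Measure.isProbabilityMeasure_map hH.aemeasurable
  have hS : MeasurableSet S := S.to_countable.measurableSet
  have hset : MeasurableSet (Prod.snd ⁻¹' S : Set (Hist A t × A)) := measurable_snd hS
  have h1 : P.map (fun ω => (history X Y I t ω, I t ω)) (Prod.snd ⁻¹' S) =
      ((P.map (history X Y I t)) ⊗ₘ (π.select t)) (Prod.snd ⁻¹' S) := by rw [hplay.law_arm t]
  rw [Measure.map_apply (hH.prodMk (hplay.measurable_arm t)) hset,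
    Measure.compProd_apply hset] at h1
  rw [← lintegral_map (Kernel.measurable_coe _ hS) hH]
  exact h1

lemma IsPlay.tendsto_measure_arm_mem_argmaxOn [Fintype A] [IsProbabilityMeasure P]
    (hplay : IsPlay M π P X Y I) (hfeas : M.feasible.Nonempty) {ε : ℕ → ℝ} (hε : ∀ t, 0 ≤ ε t)
    (hπ : π.IsConstrainedGreedy M.C ε)
    (hsum : Tendsto (fun n => ∑ t ∈ Finset.range n, ε t) atTop atTop)
    (hlim : Tendsto ε atTop (𝓝 0)) (hη : M.eta ≠ 0) :
    Tendsto (fun t => P {ω | I t ω ∈ argmaxOn M.feasible M.meanReward}) atTop (𝓝 1) := by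
  obtain ⟨δ₁, hδ₁, hcost⟩ := exists_pos_le_of_pos fun a => |M.meanCost a - M.C|
  obtain ⟨δ₂, hδ₂, hreward⟩ := exists_pos_le_of_pos
    fun p : A × A => (M.meanReward p.2 - M.meanReward p.1) / 2
  set δ := min δ₁ δ₂
  have hδ : 0 < δ := lt_min hδ₁ hδ₂
  have hδ_cost : ∀ a, δ ≤ |M.meanCost a - M.C| := fun a => (min_le_left _ _).trans
    (hcost a (abs_pos.mpr (sub_ne_zero.mpr (M.meanCost_ne_of_eta_ne_zero hη a))))
  have hδ_reward : ∀ a b, 0 < M.meanReward b - M.meanReward a →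
      2 * δ ≤ M.meanReward b - M.meanReward a := fun a b hab => by
    have h1 := (min_le_right δ₁ δ₂).trans (hreward (a, b) (half_pos hab))
    simp only at h1
    linarith
  have hR := hplay.tendsto_measure_not_accurate hε hπ hsum (obs := Prod.fst) measurable_fst
    M.meanReward
    (fun a t => ae_of_ae_map (hplay.measurable_reward a t).aemeasurable
      (by rw [hplay.law_reward a t]; exact M.reward_mem a))
    (fun a t => by
      rw [Problem.meanReward, ← hplay.law_reward a t]
      exact (integral_map (hplay.measurable_reward a t).aemeasurable
        aestronglyMeasurable_id).symm) hδ
  have hC := hplay.tendsto_measure_not_accurate hε hπ hsum (obs := Prod.snd) measurable_snd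
    M.meanCost
    (fun a t => ae_of_ae_map (hplay.measurable_cost a t).aemeasurable
      (by rw [hplay.law_cost a t]; exact M.cost_mem a))
    (fun a t => by
      rw [Problem.meanCost, ← hplay.law_cost a t]
      exact (integral_map (hplay.measurable_cost a t).aemeasurable
        aestronglyMeasurable_id).symm) hδ
  have hlow : Tendsto (fun t => ENNReal.ofReal (1 - ε t) *
      (1 - (P {ω | ¬ Accurate Prod.fst M.meanReward δ (history X Y I t ω)} +
        P {ω | ¬ Accurate Prod.snd M.meanCost δ (history X Y I t ω)}))) atTop (𝓝 1) := by
    have h1 := ENNReal.tendsto_ofReal (hlim.const_sub 1)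
    have h2 := ENNReal.Tendsto.sub (tendsto_const_nhds (x := (1 : ℝ≥0∞)) (f := atTop))
      (hR.add hC) (Or.inl ENNReal.one_ne_top)
    have h3 := ENNReal.Tendsto.mul h1 (Or.inr (by simp)) h2 (Or.inr (by simp))
    simpa using h3
  refine tendsto_of_tendsto_of_tendsto_of_le_of_le hlow tendsto_const_nhds (fun t => ?_)
    fun t => prob_le_one
  have hH := hplay.measurable_history t
  set S := {ω | Accurate Prod.fst M.meanReward δ (history X Y I t ω) ∧
    Accurate Prod.snd M.meanCost δ (history X Y I t ω)} with hS
  have hSm : MeasurableSet S := (hH (measurableSet_accurate measurable_fst _ _)).inter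
    (hH (measurableSet_accurate measurable_snd _ _))
  have hPS : 1 - (P {ω | ¬ Accurate Prod.fst M.meanReward δ (history X Y I t ω)} +
      P {ω | ¬ Accurate Prod.snd M.meanCost δ (history X Y I t ω)}) ≤ P S := by
    rw [tsub_le_iff_right, ← prob_add_prob_compl hSm (μ := P)]
    refine add_le_add_right ((measure_mono ?_).trans (measure_union_le _ _)) _
    intro ω hω
    exact not_and_or.mp hω
  calc _ ≤ ENNReal.ofReal (1 - ε t) * P S := mul_le_mul_right hPS _
    _ = ∫⁻ _ in S, ENNReal.ofReal (1 - ε t) ∂P := (setLIntegral_const _ _).symm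
    _ ≤ ∫⁻ ω in S, π.select t (history X Y I t ω) (argmaxOn M.feasible M.meanReward) ∂P :=
        setLIntegral_mono' hSm fun ω hω =>
          hπ.le_select_argmaxOn hfeas hδ_cost hδ_reward hω.1 hω.2
    _ ≤ ∫⁻ ω, π.select t (history X Y I t ω) (argmaxOn M.feasible M.meanReward) ∂P :=
        setLIntegral_le_lintegral _ _
    _ = _ := (hplay.measure_arm_mem _ t).symm

open Classical in
lemma IsPlay.sum_measure_arm_eq [Fintype A] (hplay : IsPlay M π P X Y I) (S : Set A) (t : ℕ) :
    ∑ a ∈ Finset.univ.filter (fun a => a ∈ S), P {ω | I t ω = a} = P {ω | I t ω ∈ S} := by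
  have h1 := sum_measure_preimage_singleton (μ := P) (f := I t)
    (Finset.univ.filter fun a => a ∈ S)
    (fun a _ => hplay.measurable_arm t (measurableSet_singleton a))
  have h2 : I t ⁻¹' ↑(Finset.univ.filter fun a => a ∈ S) = {ω | I t ω ∈ S} := by
    ext ω
    simp
  rw [h2] at h1
  exact h1

end Play

end CMAB

theorem corollary1 {A : Type*} [Fintype A] [MeasurableSpace A] [MeasurableSingletonClass A]
    {Ω : Type*} [MeasurableSpace Ω] (P : Measure Ω) [IsProbabilityMeasure P]
    (M : CMAB.Problem A) (hfeas : M.feasible.Nonempty)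
    (ε : ℕ → ℝ) (hε : ∀ t, ε t ∈ Set.Ioc (0 : ℝ) 1)
    (π : CMAB.Strategy A) (hπ : π.IsConstrainedGreedy M.C ε)
    (X Y : A → ℕ → Ω → ℝ) (I : ℕ → Ω → A) (hplay : CMAB.IsPlay M π P X Y I)
    (hsum : Tendsto (fun n => ∑ t ∈ Finset.range n, ε t) atTop atTop)
    (hlim : Tendsto ε atTop (𝓝 0))
    (hη : M.eta ≠ 0) (hρ : M.rho ≠ 0) :
    Tendsto (fun t => P {ω | I t ω ∈ CMAB.argmaxOn M.feasible M.meanReward}) atTop (𝓝 1) ∧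
      CMAB.IsAsymptoticallyOptimal M P I := by
  have hmain := hplay.tendsto_measure_arm_mem_argmaxOn hfeas (fun t => (hε t).1.le) hπ hsum hlim hη
  refine ⟨hmain, ?_⟩
  simp only [CMAB.IsAsymptoticallyOptimal, hplay.sum_measure_arm_eq, M.optArms_eq_argmaxOn]
  exact hmain
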